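/- Let $H\ge 1$ be an integer. Consider the deterministic chain MDP with states $s_0,\dots,s_{H+1}$ and discount factor $\gamma=H/(H+1)$, defined as follows. In each of $s_1,\dots,s_H$ four actions $a_1,a_2,a_3,a_4$ are available: in $s_i$, action $a_1$ leads to $s_{i+1}$ and each of $a_2,a_3,a_4$ leads to $s_{i-1}$. In $s_0$ only $a_1$ is available and leads to $s_1$; in $s_{H+1}$ only $a_1$ is available and the state is unchanged. The reward is $r(s_{H+1},a_1)=1$, and all other rewards are $0$. For a policy $\pi$ let $V^\pi(s)=\mathbb E\big[\sum_{t\ge 0}\gamma^t r(s_t,a_t)\,\big|\,\pi, s_0=s\big]$ and let $V^\star(s)=\sup_\pi V^\pi(s)$ over all stationary stochastic policies. Policies are parameterized directly by $\theta=(\theta_{s,a})\in\mathbb R^{3(H+2)}$, with $s$ ranging over the states and $a\in\{a_1,a_2,a_3\}$: for $s\in\{s_1,\dots,s_H\}$, $\pi_\theta(a\mid s)=\theta_{s,a}$ for $a=a_1,a_2,a_3$ and $\pi_\theta(a_4\mid s)=1-\theta_{s,a_1}-\theta_{s,a_2}-\theta_{s,a_3}$ (in $s_0$ and $s_{H+1}$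 the only available action is taken, so the coordinates of $\theta$ at these two states play no role). Let $\Theta$ be the set of those $\theta$ for which $\pi_\theta$ is a policy, i.e. all these probabilities are nonnegative. Suppose that $\theta\in\Theta$ and that, for all $s\in\{s_1,\dots,s_H\}$, $0<\theta_{s,a}<1$ for $a=a_1,a_2,a_3$ and $\theta_{s,a_1}<1/4$. Then $\theta\mapsto V^{\pi_\theta}(s_0)$, as a function on $\Theta$, is infinitely differentiable at $\theta$, and for every integer $k\ge 0$ with $$k\le \frac{H}{40\log(2H)}-1$$ the tensor $\nabla^k_\theta V^{\pi_\theta}(s_0)$ of its $k$-th order derivatives satisfies $$\big\|\nabla^k_\theta V^{\pi_\theta}(s_0)\big\|\le (1/3)^{H/4},$$ where $\|J\|=\sup_{\|u_1\|_2=\dots=\|u_k\|_2=1}|\langle J,u_1\otimes\dots\otimes u_k\rangle|$ is the operator norm of the tensor. Furthermore, $$V^\star(s_0)-V^{\pi_\theta}(s_0)\ \ge\ \frac{H+1}{8}-\frac{(H+1)^2}{3^H}.$$ (At points of $\Theta$ where some $\pi_\theta(a_4\mid s)$ vanishes, derivatives are taken within $\Theta$; elsewhere these are the ordinary derivatives.)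 -/

import Mathlib

open MeasureTheory ProbabilityTheory
open scoped ENNReal ContDiff

/-- A finite discounted Markov decision process with state space `S` and action space `A`.
Only the actions in `avail s` may be taken in state `s`; the values of `trans s a` and `r s a`
for `a ∉ avail s` are never used. -/
structure FiniteMDP (S A : Type) where
  /-- The actions that can be taken in each state. -/
  avail : S → Finset A
  /-- In every state there is an action. -/
  avail_nonempty : ∀ s, (avail s).Nonempty
  /-- The transition model: `trans s a` is the law of the next state. -/
  trans : S → A → PMF S
  /-- The reward function. -/
  r : S → A → ℝ
  r_nonneg : ∀ s a, 0 ≤ r s a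
  r_le_one : ∀ s a, r s a ≤ 1
  /-- The discount factor. -/
  γ : ℝ
  γ_nonneg : 0 ≤ γ
  γ_lt_one : γ < 1

namespace FiniteMDP

variable {S A : Type}

/-- A stationary stochastic policy: in each state a probability distribution over the actions
that are available there. -/
structure Policy (M : FiniteMDP S A) where
  /-- The law of the action taken in each state. -/
  act : S → PMF A
  act_support : ∀ s, (act s).support ⊆ M.avail s

/-- The joint law of a state with law `p` and the action that `π` takes in it. -/
noncomputable def Policy.stateAction {M : FiniteMDP S A} (π : M.Policy) (p : PMF S) :
    PMF (S × A) :=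
  p.bind fun s => (π.act s).map fun a => (s, a)

section Trajectories

variable [Fintype S] [MeasurableSpace S] [DiscreteMeasurableSpace S]
  [Fintype A] [MeasurableSpace A] [DiscreteMeasurableSpace A]

/-- One step of the controlled process: from the pair `(s_t, a_t)` to the law of
`(s_{t+1}, a_{t+1})`, where `s_{t+1} ∼ P(· | s_t, a_t)` and `a_{t+1} ∼ π(· | s_{t+1})`. -/
noncomputable def stepKernel (M : FiniteMDP S A) (π : M.Policy) : Kernel (S × A) (S × A) :=
  Kernel.ofFunOfCountable fun x => (π.stateAction (M.trans x.1 x.2)).toMeasure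

instance (M : FiniteMDP S A) (π : M.Policy) : IsMarkovKernel (M.stepKernel π) :=
  ⟨fun x => PMF.toMeasure.isProbabilityMeasure (π.stateAction (M.trans x.1 x.2))⟩

/-- The law of `(s_{n+1}, a_{n+1})` given the history up to time `n`: it depends on the last
state-action pair only. -/
noncomputable def historyKernel (M : FiniteMDP S A) (π : M.Policy) (n : ℕ) :
    Kernel ((i : Finset.Iic n) → (fun _ : ℕ => S × A) i) ((fun _ : ℕ => S × A) (n + 1)) :=
  (M.stepKernel π).comap (fun h => h ⟨n, Finset.mem_Iic.2 le_rfl⟩) (measurable_pi_apply _)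

instance (M : FiniteMDP S A) (π : M.Policy) (n : ℕ) : IsMarkovKernel (M.historyKernel π n) :=
  inferInstanceAs (IsMarkovKernel ((M.stepKernel π).comap _ (measurable_pi_apply _)))

/-- The law of the trajectory `(s_t, a_t)_{t ≥ 0}` when `s_0 = s` and the policy `π` is
executed. -/
noncomputable def trajLaw (M : FiniteMDP S A) (π : M.Policy) (s : S) : Measure (ℕ → S × A) :=
  Kernel.trajMeasure (X := fun _ : ℕ => S × A) (π.stateAction (PMF.pure s)).toMeasure
    (M.historyKernel π)

/-- The value function `V^π(s) = 𝔼[∑ γ^t r(s_t, a_t) | π, s_0 = s]`. -/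
noncomputable def value (M : FiniteMDP S A) (π : M.Policy) (s : S) : ℝ :=
  ∫ τ, ∑' t : ℕ, M.γ ^ t * M.r (τ t).1 (τ t).2 ∂(M.trajLaw π s)

/-- The optimal value `V^⋆(s)`: the supremum of `V^π(s)` over all policies `π`. -/
noncomputable def optValue (M : FiniteMDP S A) (s : S) : ℝ :=
  ⨆ π : M.Policy, M.value π s

end Trajectories

end FiniteMDP

namespace ChainMDP

/-- The states of the chain with four actions, `s_1, …, s_H`. In the end states `s_0` and
`s_{H+1}` only the action `a_1` is available. -/
def IsInner (H : ℕ) (s : Fin (H + 2)) : Prop := s ≠ 0 ∧ s ≠ Fin.last (H + 1)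

instance (H : ℕ) (s : Fin (H + 2)) : Decidable (IsInner H s) :=
  inferInstanceAs (Decidable (_ ∧ _))

/-- The successor of `s` under an action; the actions `a_1, a_2, a_3, a_4` are `0, 1, 2, 3`.
`a_1` moves one state to the right (and stays in `s_{H+1}`), the others one state to the left. -/
def next (H : ℕ) (s : Fin (H + 2)) (a : Fin 4) : Fin (H + 2) :=
  if a = 0 then ⟨min (s.val + 1) (H + 1), by omega⟩ else ⟨s.val - 1, by omega⟩

/-- The deterministic chain MDP with states `s_0, …, s_{H+1}` and discount `H / (H + 1)`. The
only nonzero reward is `r(s_{H+1}, a_1) = 1`. -/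
noncomputable def chain (H : ℕ) : FiniteMDP (Fin (H + 2)) (Fin 4) where
  avail s := if IsInner H s then Finset.univ else {0}
  avail_nonempty s := by split_ifs <;> simp
  trans s a := PMF.pure (next H s a)
  r s a := if s = Fin.last (H + 1) ∧ a = 0 then 1 else 0
  r_nonneg s a := by split_ifs <;> simp
  r_le_one s a := by split_ifs <;> simp
  γ := (H : ℝ) / (H + 1)
  γ_nonneg := by positivity
  γ_lt_one := by rw [div_lt_one (by positivity)]; linarith

/-- Parameters `θ_{s,a}` for the states `s` and the actions `a_1, a_2, a_3`, with the Euclidean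
norm. -/
abbrev Param (H : ℕ) : Type := EuclideanSpace ℝ (Fin (H + 2) × Fin 3)

/-- The action probabilities of the direct parameterization: `θ_{s,a}` for `a = a_1, a_2, a_3`
and `1 - θ_{s,a_1} - θ_{s,a_2} - θ_{s,a_3}` for `a_4`. In the end states the only available
action is taken. -/
noncomputable def directProb (H : ℕ) (θ : Param H) (s : Fin (H + 2)) : Fin 4 → ℝ :=
  if IsInner H s then
    ![θ (s, 0), θ (s, 1), θ (s, 2), 1 - θ (s, 0) - θ (s, 1) - θ (s, 2)]
  else ![1, 0, 0, 0]

lemma sum_directProb (H : ℕ) (θ : Param H) (s : Fin (H + 2)) :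
    ∑ a, directProb H θ s a = 1 := by
  unfold directProb
  split_ifs
  · simp [Fin.sum_univ_four]
  · simp [Fin.sum_univ_four]

/-- The parameters for which the direct parameterization is a policy. -/
def feasible (H : ℕ) : Set (Param H) := {θ | ∀ s a, 0 ≤ directProb H θ s a}

/-- The policy `π_θ` of the direct parameterization. -/
noncomputable def directPolicy (H : ℕ) (θ : Param H) (hθ : θ ∈ feasible H) :
    (chain H).Policy where
  act s := PMF.ofFintype (fun a => ENNReal.ofReal (directProb H θ s a)) (by
    rw [← ENNReal.ofReal_sum_of_nonneg fun a _ => hθ s a, sum_directProb, ENNReal.ofReal_one])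
  act_support s a ha := by
    by_cases hs : IsInner H s
    · simp [chain, hs]
    · have h : a = 0 := by
        by_contra hne
        apply (PMF.mem_support_iff _ _).1 ha
        fin_cases a <;> simp_all [directProb]
      simp [chain, hs, h]

open Classical in
/-- The objective `θ ↦ V^{π_θ}(s_0)` on the set of feasible parameters. The value outside of
that set is a placeholder and is not used. -/
noncomputable def objective (H : ℕ) (θ : Param H) : ℝ :=
  if hθ : θ ∈ feasible H then (chain H).value (directPolicy H θ hθ) 0 else 0

end ChainMDP

/-! ### From trajectory measures to the Bellman equation. -/

namespace FiniteMDP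

variable {S A : Type}

/-! Below probability 1/4 of moving right, the chain drifts left so strongly that the reward at the
far end is exponentially invisible from the start. This is measured in a weighted sup norm: the
weights `weight H n` equal 1 at the start and grow like 3^n/(4H). In this norm the discounted
transition operator A has norm at most 1 - 1/(2(H+1)) (`weight_drift`, `norm_stepOp_le`), while the
reward has norm at most 4H/3^(H+1) (`norm_conjRew_le`). Hence the resolvent R = (1 - A)⁻¹ has norm
at most 2(H+1), and the value V = R r has norm at most 8H(H+1)/3^(H+1).

The operator is affine in θ: a displacement z adds D z, with ‖D z‖ ≤ 4H/(H+1) ‖z‖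
(`norm_stepDir_le`). Therefore V(θ + z) = (1 - R D z)⁻¹ V(θ) for small z with θ + z feasible
(`objective_eq_resolvent`), a geometric series in R D z. Reading off its coefficients bounds the
k-th derivative by k! ‖V‖ (8H)^k, and for k in the stated range 3^(-H) absorbs the factors
polynomial in H.

For the gap, the policy that always moves right earns (H+1) γ^(H+1), to be compared with the same
bound on V. -/

/-- The mean of `f` over the action that `π` takes in the state `s`. -/
noncomputable def Policy.mean [Fintype A] {M : FiniteMDP S A} (π : M.Policy) (f : S × A → ℝ)
    (s : S) : ℝ :=
  ∑ a, (π.act s a).toReal * f (s, a)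

section

variable [Fintype S] [MeasurableSpace S] [DiscreteMeasurableSpace S]
  [Fintype A] [MeasurableSpace A] [DiscreteMeasurableSpace A]

lemma integral_stateAction {M : FiniteMDP S A} (π : M.Policy) (p : PMF S) (f : S × A → ℝ) :
    ∫ x, f x ∂(π.stateAction p).toMeasure = ∑ s, (p s).toReal * π.mean f s := by
  classical
  rw [PMF.integral_eq_sum, Fintype.sum_prod_type]
  refine Finset.sum_congr rfl fun s _ => ?_
  rw [Policy.mean, Finset.mul_sum]
  refine Finset.sum_congr rfl fun a _ => ?_
  have h : π.stateAction p (s, a) = p s * π.act s a := by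
    rw [Policy.stateAction, PMF.bind_apply, tsum_fintype, Finset.sum_eq_single s]
    · congr 1
      rw [PMF.map_apply, tsum_fintype, Finset.sum_eq_single a] <;> simp +contextual [eq_comm]
    · intro b _ hb
      rw [PMF.map_apply, tsum_fintype, Finset.sum_eq_zero, mul_zero]
      intro c _
      simp [hb.symm]
    · simp
  rw [h, ENNReal.toReal_mul, smul_eq_mul, mul_assoc]

/-- The mean of `f (s_{t+1}, a_{t+1})` given the pair `(s_t, a_t)`. -/
noncomputable def nextMean (M : FiniteMDP S A) (π : M.Policy) (f : S × A → ℝ) (x : S × A) : ℝ :=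
  ∫ y, f y ∂(M.stepKernel π x)

lemma nextMean_apply (M : FiniteMDP S A) (π : M.Policy) (f : S × A → ℝ) (x : S × A) :
    M.nextMean π f x = ∑ s, (M.trans x.1 x.2 s).toReal * π.mean f s :=
  integral_stateAction π (M.trans x.1 x.2) f

instance (M : FiniteMDP S A) (π : M.Policy) (s : S) : IsProbabilityMeasure (M.trajLaw π s) := by
  unfold trajLaw
  infer_instance

lemma integrable_eval (M : FiniteMDP S A) (π : M.Policy) (s : S) (f : S × A → ℝ) (n : ℕ) :
    Integrable (fun τ : ℕ → S × A => f (τ n)) (M.trajLaw π s) := by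
  have hf : Integrable f ((M.trajLaw π s).map fun τ => τ n) := by
    have : IsProbabilityMeasure ((M.trajLaw π s).map fun τ => τ n) :=
      Measure.isProbabilityMeasure_map (measurable_pi_apply n).aemeasurable
    exact Integrable.of_finite
  exact hf.comp_measurable (measurable_pi_apply n)

/-- The history up to time n together with the next pair is distributed as the composition product
of the history law with `historyKernel`; integrating out the last coordinate leaves `nextMean`. -/
lemma integral_eval_succ (M : FiniteMDP S A) (π : M.Policy) (s : S) (f : S × A → ℝ) (n : ℕ) :
    ∫ τ, f (τ (n + 1)) ∂(M.trajLaw π s) = ∫ τ, M.nextMean π f (τ n) ∂(M.trajLaw π s) := by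
  have key := Kernel.map_frestrictLe_trajMeasure_compProd_eq_map_trajMeasure
    (X := fun _ : ℕ => S × A) (μ₀ := (π.stateAction (PMF.pure s)).toMeasure)
    (κ := M.historyKernel π) (a := n)
  change (M.trajLaw π s).map _ ⊗ₘ _ = (M.trajLaw π s).map _ at key
  have hm : Measurable fun τ : ℕ → S × A => (Preorder.frestrictLe (π := fun _ : ℕ => S × A) n τ,
      τ (n + 1)) := by fun_prop
  have hi : Integrable (fun z : ((i : Finset.Iic n) → (fun _ : ℕ => S × A) i) × (S × A) => f z.2)
      ((M.trajLaw π s).map fun τ => (Preorder.frestrictLe (π := fun _ : ℕ => S × A) n τ,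
        τ (n + 1))) := by
    rw [integrable_map_measure _ hm.aemeasurable]
    · exact M.integrable_eval π s f (n + 1)
    · exact ((measurable_of_countable f).comp measurable_snd).aestronglyMeasurable
  have h1 : ∫ τ, f (τ (n + 1)) ∂(M.trajLaw π s) = ∫ z, f z.2 ∂((M.trajLaw π s).map fun τ =>
      (Preorder.frestrictLe (π := fun _ : ℕ => S × A) n τ, τ (n + 1))) := by
    rw [integral_map hm.aemeasurable hi.1]
  have hi' := hi
  rw [← key] at hi'
  rw [h1, ← key, Measure.integral_compProd hi',
    integral_map (Preorder.measurable_frestrictLe n).aemeasurable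
      hi'.integral_compProd.aestronglyMeasurable]
  rfl

lemma integral_eval_zero (M : FiniteMDP S A) (π : M.Policy) (s : S) (f : S × A → ℝ) :
    ∫ τ, f (τ 0) ∂(M.trajLaw π s) = π.mean f s := by
  have h : (M.trajLaw π s).map (Preorder.frestrictLe (π := fun _ : ℕ => S × A) 0) =
      (π.stateAction (PMF.pure s)).toMeasure.map
        (MeasurableEquiv.piUnique (fun _ : Finset.Iic 0 => S × A)).symm := by
    rw [trajLaw, Kernel.trajMeasure, Measure.map_comp _ _ (by fun_prop),
      Kernel.traj_map_frestrictLe, Kernel.partialTraj_self, Measure.id_comp]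
  have hm : Measurable fun x : Finset.Iic 0 → S × A => f (x ⟨0, by simp⟩) :=
    (measurable_of_countable f).comp (measurable_pi_apply _)
  have h1 := integral_map (μ := M.trajLaw π s)
    (Preorder.measurable_frestrictLe (X := fun _ : ℕ => S × A) 0).aemeasurable
    (f := fun x : Finset.Iic 0 → S × A => f (x ⟨0, by simp⟩)) hm.aestronglyMeasurable
  rw [h, integral_map (by fun_prop) hm.aestronglyMeasurable] at h1
  refine h1.symm.trans ((integral_stateAction π (PMF.pure s) f).trans ?_)
  rw [Finset.sum_eq_single s] <;> simp +contextual [PMF.pure_apply]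

lemma integral_eval (M : FiniteMDP S A) (π : M.Policy) (s : S) (f : S × A → ℝ) (n : ℕ) :
    ∫ τ, f (τ n) ∂(M.trajLaw π s) = π.mean ((M.nextMean π)^[n] f) s := by
  induction n generalizing f with
  | zero => exact M.integral_eval_zero π s f
  | succ n ih => rw [integral_eval_succ, ih, Function.iterate_succ_apply]

/-- The mean of the reward that is collected at time `t`. -/
noncomputable def meanReward (M : FiniteMDP S A) (π : M.Policy) (t : ℕ) (s : S) : ℝ :=
  ∫ τ, M.r (τ t).1 (τ t).2 ∂(M.trajLaw π s)

lemma meanReward_eq (M : FiniteMDP S A) (π : M.Policy) (t : ℕ) (s : S) :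
    M.meanReward π t s = π.mean ((M.nextMean π)^[t] fun x => M.r x.1 x.2) s :=
  M.integral_eval π s (fun x => M.r x.1 x.2) t

lemma meanReward_succ (M : FiniteMDP S A) (π : M.Policy) (t : ℕ) (s : S) :
    M.meanReward π (t + 1) s =
      ∑ a, (π.act s a).toReal * ∑ s', (M.trans s a s').toReal * M.meanReward π t s' := by
  simp_rw [meanReward_eq, Function.iterate_succ_apply', Policy.mean, nextMean_apply, Policy.mean]

lemma norm_meanReward_le (M : FiniteMDP S A) (π : M.Policy) (t : ℕ) (s : S) :
    ‖M.meanReward π t s‖ ≤ 1 := by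
  refine (norm_integral_le_of_norm_le_const (C := 1) (.of_forall fun τ => ?_)).trans (by simp)
  rw [Real.norm_of_nonneg (M.r_nonneg _ _)]
  exact M.r_le_one _ _

/-- Domination by γ^t allows exchanging the sum and the expectation. -/
lemma hasSum_value (M : FiniteMDP S A) (π : M.Policy) (s : S) :
    HasSum (fun t => M.γ ^ t * M.meanReward π t s) (M.value π s) := by
  have hb : ∀ (t : ℕ) (τ : ℕ → S × A), ‖M.γ ^ t * M.r (τ t).1 (τ t).2‖ ≤ M.γ ^ t := by
    intro t τ
    have hg := pow_nonneg M.γ_nonneg t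
    rw [Real.norm_of_nonneg (mul_nonneg hg (M.r_nonneg _ _))]
    exact mul_le_of_le_one_right hg (M.r_le_one _ _)
  have hs : Summable fun t => M.γ ^ t := summable_geometric_of_lt_one M.γ_nonneg M.γ_lt_one
  have hi : ∀ t, Integrable (fun τ : ℕ → S × A => M.γ ^ t * M.r (τ t).1 (τ t).2)
      (M.trajLaw π s) :=
    fun t => (M.integrable_eval π s (fun x => M.r x.1 x.2) t).const_mul _
  have h := hasSum_integral_of_summable_integral_norm hi (hs.of_nonneg_of_le
    (fun t => integral_nonneg fun τ => norm_nonneg _) fun t => by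
      refine (integral_mono (hi t).norm (integrable_const (M.γ ^ t)) (hb t)).trans (by simp))
  simp only [integral_const_mul] at h
  exact h

/-- The Bellman equation. -/
theorem value_eq (M : FiniteMDP S A) (π : M.Policy) (s : S) :
    M.value π s = ∑ a, (π.act s a).toReal *
      (M.r s a + M.γ * ∑ s', (M.trans s a s').toReal * M.value π s') := by
  have h : HasSum (fun t => M.γ ^ (t + 1) * M.meanReward π (t + 1) s)
      (∑ a, (π.act s a).toReal * (M.γ * ∑ s', (M.trans s a s').toReal * M.value π s')) := by
    have h' := hasSum_sum (s := Finset.univ) fun a _ => (((hasSum_sum (s := Finset.univ)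
      fun s' _ => (M.hasSum_value π s').mul_left (M.trans s a s').toReal).mul_left M.γ).mul_left
        (π.act s a).toReal)
    refine h'.congr_fun fun t => ?_
    rw [meanReward_succ, Finset.mul_sum]
    refine Finset.sum_congr rfl fun a _ => ?_
    simp_rw [Finset.mul_sum]
    refine Finset.sum_congr rfl fun s' _ => ?_
    ring
  have h1 := (hasSum_nat_add_iff (f := fun t => M.γ ^ t * M.meanReward π t s) 1).1 h
  rw [(M.hasSum_value π s).unique h1, Finset.sum_range_one, meanReward_eq]
  simp [Policy.mean, mul_add, Finset.sum_add_distrib, add_comm]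

lemma value_le (M : FiniteMDP S A) (π : M.Policy) (s : S) : M.value π s ≤ (1 - M.γ)⁻¹ := by
  refine hasSum_le (fun t => ?_) (M.hasSum_value π s)
    (hasSum_geometric_of_lt_one M.γ_nonneg M.γ_lt_one)
  exact mul_le_of_le_one_right (pow_nonneg M.γ_nonneg t)
    ((Real.le_norm_self _).trans (M.norm_meanReward_le π t s))

lemma value_le_optValue (M : FiniteMDP S A) (π : M.Policy) (s : S) :
    M.value π s ≤ M.optValue s :=
  le_ciSup (f := fun π : M.Policy => M.value π s)
    ⟨(1 - M.γ)⁻¹, Set.forall_mem_range.2 fun π => M.value_le π s⟩ π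

end

end FiniteMDP

/-! ### Derivatives of a resolvent along a linear perturbation. -/

section Resolvent

variable {E X : Type*} [NormedAddCommGroup E] [NormedSpace ℝ E]
  [NormedAddCommGroup X] [NormedSpace ℝ X]

/-- The Taylor series of the resolvent `z ↦ L (1 - T (z - θ))⁻¹`. -/
noncomputable def resolventSeries (T : E →L[ℝ] (X →L[ℝ] X)) (L : (X →L[ℝ] X) →L[ℝ] ℝ) :
    FormalMultilinearSeries ℝ E ℝ :=
  L.compFormalMultilinearSeries
    ((formalMultilinearSeries_geometric ℝ (X →L[ℝ] X)).compContinuousLinearMap T)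

lemma norm_resolventSeries_le [Nontrivial X] (T : E →L[ℝ] (X →L[ℝ] X))
    (L : (X →L[ℝ] X) →L[ℝ] ℝ) (k : ℕ) :
    ‖resolventSeries T L k‖ ≤ ‖L‖ * ‖T‖ ^ k := by
  refine (ContinuousLinearMap.norm_compContinuousMultilinearMap_le _ _).trans ?_
  refine mul_le_mul_of_nonneg_left ?_ (norm_nonneg _)
  refine (FormalMultilinearSeries.norm_compContinuousLinearMap_le _ _ _).trans ?_
  rw [formalMultilinearSeries_geometric_apply_norm, one_mul]

lemma hasFPowerSeriesOnBall_resolvent [CompleteSpace X] (T : E →L[ℝ] (X →L[ℝ] X))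
    (L : (X →L[ℝ] X) →L[ℝ] ℝ) (θ : E) :
    HasFPowerSeriesOnBall (fun θ' => L (Ring.inverse (1 - T (θ' - θ)))) (resolventSeries T L) θ
      (1 / ‖T‖ₑ) := by
  have h := hasFPowerSeriesOnBall_inverse_one_sub ℝ (X →L[ℝ] X)
  rw [← map_zero T] at h
  have h1 := (L.comp_hasFPowerSeriesOnBall (h.compContinuousLinearMap (u := T))).comp_sub θ
  rw [zero_add] at h1
  exact h1

/-- Agreement with the analytic resolvent is needed only on `s` near θ, so placeholder values of `f`
outside `s` do no harm. -/
lemma contDiffWithinAt_and_norm_iteratedFDerivWithin_le_of_resolvent [CompleteSpace X]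
    [Nontrivial X] {s : Set E} (hs : UniqueDiffOn ℝ s) {θ : E} (hθ : θ ∈ s)
    (T : E →L[ℝ] (X →L[ℝ] X)) (L : (X →L[ℝ] X) →L[ℝ] ℝ) {f : E → ℝ}
    (hf : ∀ θ' ∈ s, ‖T (θ' - θ)‖ < 1 → f θ' = L (Ring.inverse (1 - T (θ' - θ)))) :
    ContDiffWithinAt ℝ ∞ f s θ ∧
      ∀ k, ‖iteratedFDerivWithin ℝ k f s θ‖ ≤ k.factorial * (‖L‖ * ‖T‖ ^ k) := by
  have hp := hasFPowerSeriesOnBall_resolvent T L θ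
  have hev : f =ᶠ[nhdsWithin θ s] fun θ' => L (Ring.inverse (1 - T (θ' - θ))) := by
    have hc : Filter.Tendsto (fun θ' => ‖T (θ' - θ)‖) (nhds θ) (nhds 0) := by
      have : Continuous fun θ' => ‖T (θ' - θ)‖ := by fun_prop
      simpa using this.tendsto θ
    filter_upwards [self_mem_nhdsWithin,
      mem_nhdsWithin_of_mem_nhds (hc.eventually_lt_const zero_lt_one)] with θ' h1 h2
    exact hf θ' h1 h2
  have hfθ := hf θ hθ (by simp)
  refine ⟨(hp.analyticAt.contDiffAt.contDiffWithinAt.congr_of_eventuallyEq hev hfθ), fun k => ?_⟩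
  rw [hev.iteratedFDerivWithin_eq hfθ k]
  refine ContinuousMultilinearMap.opNorm_le_bound (by positivity) fun v => ?_
  -- The k-th derivative symmetrizes the k-th coefficient over all permutations of its arguments,
  -- hence the factor k!.
  rw [(hp.hasFPowerSeriesWithinOnBall (s := s)).iteratedFDerivWithin_eq_sum_of_completeSpace hs hθ]
  refine (norm_sum_le_of_le _ (f := fun σ : Equiv.Perm (Fin k) => _)
    (n := fun _ => ‖L‖ * ‖T‖ ^ k * ∏ i, ‖v i‖) fun σ _ => ?_).trans_eq ?_
  · refine (ContinuousMultilinearMap.le_opNorm _ _).trans ?_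
    rw [Equiv.prod_comp σ fun i => ‖v i‖]
    exact mul_le_mul_of_nonneg_right (norm_resolventSeries_le T L k)
      (Finset.prod_nonneg fun i _ => norm_nonneg _)
  · rw [Finset.sum_const, Finset.card_univ, Fintype.card_perm, Fintype.card_fin, nsmul_eq_mul]
    ring

end Resolvent

/-! ### The chain in a weighted sup norm. -/

namespace ChainMDP

/-- The successor of a state under the action `a_1`. -/
def up (H : ℕ) (s : Fin (H + 2)) : Fin (H + 2) := next H s 0

/-- The successor of a state under each of the actions `a_2, a_3, a_4`. -/
def down (H : ℕ) (s : Fin (H + 2)) : Fin (H + 2) := next H s 1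

/-- The reward of the action `a_1`. -/
noncomputable def rew (H : ℕ) (s : Fin (H + 2)) : ℝ := if s = Fin.last (H + 1) then 1 else 0

lemma gamma_eq (H : ℕ) : (chain H).γ = (H : ℝ) / (H + 1) := rfl

/-- The last three actions share their successor and earn nothing, so the value depends on θ only
through the probability of the first action. -/
lemma value_directPolicy (H : ℕ) (θ : Param H) (hθ : θ ∈ feasible H) (s : Fin (H + 2)) :
    (chain H).value (directPolicy H θ hθ) s = rew H s + (H : ℝ) / (H + 1) *
      (directProb H θ s 0 * (chain H).value (directPolicy H θ hθ) (up H s) +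
        (1 - directProb H θ s 0) * (chain H).value (directPolicy H θ hθ) (down H s)) := by
  have ht : ∀ a, ∑ s', ((chain H).trans s a s').toReal *
      (chain H).value (directPolicy H θ hθ) s' =
        (chain H).value (directPolicy H θ hθ) (next H s a) := by
    intro a
    rw [Finset.sum_eq_single (next H s a)] <;> simp +contextual [chain, PMF.pure_apply]
  have ha : ∀ a, ((directPolicy H θ hθ).act s a).toReal = directProb H θ s a := fun a =>
    ENNReal.toReal_ofReal (hθ s a)
  have hn : ∀ a, a ≠ 0 → next H s a = down H s := fun a h => by
    simp [down, next, h]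
  have hr : directProb H θ s 0 * (chain H).r s 0 = rew H s := by
    by_cases h : s = Fin.last (H + 1)
    · simp [chain, rew, h, directProb, IsInner]
    · simp [chain, rew, h]
  have hsum := sum_directProb H θ s
  rw [Fin.sum_univ_four] at hsum
  rw [FiniteMDP.value_eq]
  simp_rw [ht, ha]
  have hr' : ∀ a, a ≠ 0 → (chain H).r s a = 0 := fun a h => by simp [chain, h]
  rw [Fin.sum_univ_four, hn 1 (by decide), hn 2 (by decide), hn 3 (by decide), hr' 1 (by decide),
    hr' 2 (by decide), hr' 3 (by decide), ← hr, gamma_eq]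
  change _ * (_ + _ * (chain H).value _ (up H s)) + _ + _ + _ = _
  linear_combination (H : ℝ) / (H + 1) * (chain H).value (directPolicy H θ hθ) (down H s) * hsum

/-- The weights of the norm in which the transitions are contracting. -/
noncomputable def weight (H : ℕ) (n : ℕ) : ℝ := 1 + (3 ^ n - 1) / (4 * H)

lemma one_le_weight (H n : ℕ) : 1 ≤ weight H n := by
  have : (1 : ℝ) ≤ 3 ^ n := one_le_pow₀ (by norm_num)
  have : 0 ≤ ((3 : ℝ) ^ n - 1) / (4 * H) := div_nonneg (by linarith) (by positivity)
  unfold weight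
  linarith

lemma weight_pos (H n : ℕ) : 0 < weight H n := one_pos.trans_le (one_le_weight H n)

lemma weight_succ (H n : ℕ) : weight H (n + 1) = weight H n + 2 * 3 ^ n / (4 * H) := by
  unfold weight
  ring

lemma weight_mono (H : ℕ) : Monotone (weight H) :=
  monotone_nat_of_le_succ fun n => by
    rw [weight_succ]
    exact le_add_of_nonneg_right (by positivity)

lemma weight_succ_le {H : ℕ} (hH : 1 ≤ H) (n : ℕ) : weight H (n + 1) ≤ 3 * weight H n := by
  have h : (1 : ℝ) ≤ H := by exact_mod_cast hH
  have h2 : (1 : ℝ) / (4 * H) ≤ 1 := by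
    rw [div_le_one (by positivity)]
    linarith
  have e : 3 * weight H n - weight H (n + 1) = 2 * (1 - 1 / (4 * H)) := by
    unfold weight
    ring
  linarith

lemma weight_up_le {H : ℕ} (hH : 1 ≤ H) (s : Fin (H + 2)) :
    weight H (up H s) ≤ 3 * weight H s :=
  (weight_mono H (by simp [up, next])).trans (weight_succ_le hH s)

lemma weight_down_le (H : ℕ) (s : Fin (H + 2)) : weight H (down H s) ≤ weight H s :=
  weight_mono H (by simp [down, next])

/-- The form of the weights serves two needs. In inner states the growth factor 3 makes them
supermartingale exactly up to probability 1/4. At the left end the chain must move up; the divisor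
4H keeps that first increment at 1/(2H), which uses up half of the discount. -/
lemma weight_drift {H : ℕ} (hH : 1 ≤ H) {θ : Param H} (hθ : θ ∈ feasible H)
    (hθ1 : ∀ s, IsInner H s → θ (s, 0) < 1 / 4) (s : Fin (H + 2)) :
    (H : ℝ) / (H + 1) * (directProb H θ s 0 * weight H (up H s) +
      (1 - directProb H θ s 0) * weight H (down H s)) ≤ (1 - 1 / (2 * (H + 1))) * weight H s := by
  have h : (1 : ℝ) ≤ H := by exact_mod_cast hH
  have hg : (H : ℝ) / (H + 1) ≤ 1 - 1 / (2 * (H + 1)) := by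
    have : (1 : ℝ) - 1 / (2 * (H + 1)) - H / (H + 1) = 1 / (2 * (H + 1)) := by
      field_simp
      ring
    have : (0 : ℝ) < 1 / (2 * (H + 1)) := by positivity
    linarith
  by_cases hs : IsInner H s
  · have hp : directProb H θ s 0 = θ (s, 0) := by simp [directProb, hs]
    have hp0 := hθ s 0
    have hp1 := hθ1 s hs
    rw [hp] at hp0 ⊢
    refine mul_le_mul hg ?_ ?_ ?_
    · obtain ⟨m, hm⟩ : ∃ m, (s : ℕ) = m + 1 :=
        Nat.exists_eq_succ_of_ne_zero fun h => hs.1 (Fin.ext h)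
      have hl : (s : ℕ) < H + 1 := by
        have := s.isLt
        have : (s : ℕ) ≠ H + 1 := fun h => hs.2 (Fin.ext h)
        omega
      have hu : (up H s : ℕ) = m + 1 + 1 := by simp [up, next]; omega
      have hd : (down H s : ℕ) = m := by simp [down, next]; omega
      rw [hu, hd, hm, weight_succ, weight_succ]
      have hc : 0 ≤ (3 : ℝ) ^ m / (4 * H) := by positivity
      -- With c = 3^m/(4H), the mean weight exceeds `weight H m` by 8pc, and the current weight by
      -- 2c, so p ≤ 1/4 suffices.
      have e : ∀ p : ℝ, p * (weight H m + 2 * 3 ^ m / (4 * H) + 2 * 3 ^ (m + 1) / (4 * H)) +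
          (1 - p) * weight H m = weight H m + 8 * p * (3 ^ m / (4 * H)) := fun p => by ring
      rw [e, mul_div_assoc]
      nlinarith
    · have := weight_pos H (up H s)
      have := weight_pos H (down H s)
      have : 0 ≤ 1 - θ (s, 0) := by linarith
      positivity
    · refine le_trans (by positivity) hg
  · have hp : directProb H θ s 0 = 1 := by simp [directProb, hs]
    rw [hp, sub_self, zero_mul, add_zero, one_mul]
    by_cases h0 : s = 0
    · subst h0
      have hu : (up H 0 : ℕ) = 1 := by simp [up, next]
      rw [hu]
      simp only [weight, Fin.val_zero, pow_zero, pow_one]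
      -- The left end is the extremal state: the contraction rate is attained there.
      apply le_of_eq
      field_simp
      ring
    · have hl : s = Fin.last (H + 1) := by
        by_contra h1
        exact hs ⟨h0, h1⟩
      have hu : (up H s : ℕ) = s := by simp [hl, up, next]
      rw [hu]
      exact mul_le_mul_of_nonneg_right hg (weight_pos H s).le

/-- The transitions under the probabilities `p` of moving to the right and `q` of moving to the
left, discounted and conjugated by the weights. -/
noncomputable def conjStep (H : ℕ) (p q : Fin (H + 2) → ℝ) :
    (Fin (H + 2) → ℝ) →ₗ[ℝ] (Fin (H + 2) → ℝ) where
  toFun x s := (H : ℝ) / (H + 1) / weight H s * (p s * (weight H (up H s) * x (up H s)) +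
    q s * (weight H (down H s) * x (down H s)))
  map_add' x y := by
    ext s
    simp only [Pi.add_apply]
    ring
  map_smul' c x := by
    ext s
    simp only [Pi.smul_apply, smul_eq_mul, RingHom.id_apply]
    ring

lemma norm_conjStep_le {H : ℕ} {p q : Fin (H + 2) → ℝ} {C : ℝ} (hC : 0 ≤ C)
    (h : ∀ s, (H : ℝ) / (H + 1) * (|p s| * weight H (up H s) + |q s| * weight H (down H s)) ≤
      C * weight H s) (x : Fin (H + 2) → ℝ) : ‖conjStep H p q x‖ ≤ C * ‖x‖ := by
  rw [pi_norm_le_iff_of_nonneg (by positivity)]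
  intro s
  have hw := weight_pos H s
  have hu := weight_pos H (up H s)
  have hd := weight_pos H (down H s)
  have h1 : |p s * (weight H (up H s) * x (up H s)) +
      q s * (weight H (down H s) * x (down H s))| ≤
      (|p s| * weight H (up H s) + |q s| * weight H (down H s)) * ‖x‖ := by
    refine (abs_add_le _ _).trans ?_
    simp only [abs_mul, abs_of_pos hu, abs_of_pos hd, ← mul_assoc]
    rw [add_mul]
    gcongr
    · exact norm_le_pi_norm x _
    · exact norm_le_pi_norm x _
  change |(H : ℝ) / (H + 1) / weight H s * _| ≤ _
  rw [abs_mul, abs_of_nonneg (by positivity)]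
  calc _ ≤ (H : ℝ) / (H + 1) / weight H s *
        ((|p s| * weight H (up H s) + |q s| * weight H (down H s)) * ‖x‖) := by gcongr
    _ = (H : ℝ) / (H + 1) * (|p s| * weight H (up H s) + |q s| * weight H (down H s)) /
        weight H s * ‖x‖ := by ring
    _ ≤ C * ‖x‖ := by
        gcongr
        rw [div_le_iff₀ hw]
        exact h s

/-- The transitions of `π_θ`, discounted and conjugated by the weights. -/
noncomputable def stepOp (H : ℕ) (θ : Param H) :
    (Fin (H + 2) → ℝ) →L[ℝ] (Fin (H + 2) → ℝ) :=
  LinearMap.toContinuousLinearMap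
    (conjStep H (fun s => directProb H θ s 0) (fun s => 1 - directProb H θ s 0))

lemma norm_stepOp_le {H : ℕ} (hH : 1 ≤ H) {θ : Param H} (hθ : θ ∈ feasible H)
    (hθ1 : ∀ s, IsInner H s → θ (s, 0) < 1 / 4) : ‖stepOp H θ‖ ≤ 1 - 1 / (2 * (H + 1)) := by
  have h : (1 : ℝ) ≤ H := by exact_mod_cast hH
  have hC : (0 : ℝ) ≤ 1 - 1 / (2 * (H + 1)) := by
    rw [sub_nonneg, div_le_one (by positivity)]
    linarith
  refine ContinuousLinearMap.opNorm_le_bound _ hC fun x => norm_conjStep_le hC (fun s => ?_) x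
  have h0 := hθ s 0
  have h1 : directProb H θ s 0 ≤ 1 := by
    rw [← sum_directProb H θ s]
    exact Finset.single_le_sum (fun a _ => hθ s a) (Finset.mem_univ 0)
  rw [abs_of_nonneg h0, abs_of_nonneg (by linarith)]
  exact weight_drift hH hθ hθ1 s

/-- The change of the probability of moving to the right under a change `z` of the parameter. -/
noncomputable def probDir (H : ℕ) (z : Param H) (s : Fin (H + 2)) : ℝ :=
  if IsInner H s then z (s, 0) else 0

lemma abs_probDir_le (H : ℕ) (z : Param H) (s : Fin (H + 2)) : |probDir H z s| ≤ ‖z‖ := by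
  unfold probDir
  split_ifs
  · exact PiLp.norm_apply_le z (s, 0)
  · simp

/-- The constant 4 is 3 + 1: a step right at most triples the weight, a step left does not increase
it. -/
lemma norm_conjStep_probDir_le {H : ℕ} (hH : 1 ≤ H) (z : Param H) (x : Fin (H + 2) → ℝ) :
    ‖conjStep H (probDir H z) (fun s => -probDir H z s) x‖ ≤
      4 * ((H : ℝ) / (H + 1)) * ‖z‖ * ‖x‖ := by
  refine norm_conjStep_le (by positivity) (fun s => ?_) x
  rw [abs_neg]
  have h1 := abs_probDir_le H z s
  have h2 := weight_up_le hH s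
  have h3 := weight_down_le H s
  have h4 := weight_pos H s
  have h5 := weight_pos H (up H s)
  have h6 := weight_pos H (down H s)
  calc _ = (H : ℝ) / (H + 1) * (|probDir H z s| * (weight H (up H s) + weight H (down H s))) := by
        ring
    _ ≤ (H : ℝ) / (H + 1) * (‖z‖ * (3 * weight H s + weight H s)) := by gcongr
    _ = _ := by ring

/-- The dependence of `stepOp H θ` on `θ`. -/
noncomputable def stepDir {H : ℕ} (hH : 1 ≤ H) :
    Param H →L[ℝ] ((Fin (H + 2) → ℝ) →L[ℝ] (Fin (H + 2) → ℝ)) :=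
  LinearMap.mkContinuous₂
    (LinearMap.mk₂ ℝ (fun z x => conjStep H (probDir H z) (fun s => -probDir H z s) x)
      (fun z z' x => by
        ext s
        simp only [conjStep, probDir, LinearMap.coe_mk, AddHom.coe_mk, Pi.add_apply]
        split_ifs
        · simp only [PiLp.add_apply]
          ring
        · ring)
      (fun c z x => by
        ext s
        simp only [conjStep, probDir, LinearMap.coe_mk, AddHom.coe_mk, Pi.smul_apply, smul_eq_mul]
        split_ifs
        · simp only [PiLp.smul_apply, smul_eq_mul]
          ring
        · ring)
      (fun z x y => map_add _ x y) (fun c z x => map_smul _ c x))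
    (4 * ((H : ℝ) / (H + 1))) (norm_conjStep_probDir_le hH)

lemma stepDir_apply {H : ℕ} (hH : 1 ≤ H) (z : Param H) (x : Fin (H + 2) → ℝ) :
    stepDir hH z x = conjStep H (probDir H z) (fun s => -probDir H z s) x := rfl

lemma norm_stepDir_le {H : ℕ} (hH : 1 ≤ H) : ‖stepDir hH‖ ≤ 4 * ((H : ℝ) / (H + 1)) :=
  LinearMap.mkContinuous₂_norm_le _ (by positivity) _

lemma stepOp_add_stepDir {H : ℕ} (hH : 1 ≤ H) (θ θ' : Param H) :
    stepOp H θ' = stepOp H θ + stepDir hH (θ' - θ) := by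
  ext x s
  rw [add_apply, stepDir_apply]
  by_cases hs : IsInner H s
  · simp [stepOp, conjStep, directProb, probDir, hs]
    ring
  · simp [stepOp, conjStep, directProb, probDir, hs]

end ChainMDP

/-! ### Neumann series and the value function as a resolvent. -/

lemma inverse_one_sub_apply_of_eq {X : Type*} [NormedAddCommGroup X] [NormedSpace ℝ X]
    [CompleteSpace X] {A : X →L[ℝ] X} (hA : ‖A‖ < 1) {x b : X} (h : x = A x + b) :
    Ring.inverse (1 - A) b = x := by
  have h1 : b = (1 - A) x := by
    rw [sub_apply, one_apply_eq_self, eq_sub_iff_add_eq, add_comm]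
    exact h.symm
  rw [h1, ← mul_apply_eq_comp,
    Ring.inverse_mul_cancel _ (isUnit_one_sub_of_norm_lt_one hA), one_apply_eq_self]

lemma norm_inverse_one_sub_le {X : Type*} [NormedAddCommGroup X] [NormedSpace ℝ X]
    [CompleteSpace X] [Nontrivial X] {A : X →L[ℝ] X} (hA : ‖A‖ < 1) :
    ‖Ring.inverse (1 - A)‖ ≤ (1 - ‖A‖)⁻¹ := by
  rw [← geom_series_eq_inverse A hA]
  refine (tsum_geometric_le_of_norm_lt_one A hA).trans_eq ?_
  rw [norm_one]
  ring

namespace ChainMDP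

/-- The value function of `π_θ` divided by the weights. -/
noncomputable def conjValue (H : ℕ) (θ : Param H) (hθ : θ ∈ feasible H) (s : Fin (H + 2)) : ℝ :=
  (chain H).value (directPolicy H θ hθ) s / weight H s

/-- The reward divided by the weights. -/
noncomputable def conjRew (H : ℕ) (s : Fin (H + 2)) : ℝ := rew H s / weight H s

lemma conjValue_eq (H : ℕ) (θ : Param H) (hθ : θ ∈ feasible H) :
    conjValue H θ hθ = stepOp H θ (conjValue H θ hθ) + conjRew H := by
  ext s
  have hv := fun s => (weight_pos H s).ne'
  change conjValue H θ hθ s = (H : ℝ) / (H + 1) / weight H s *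
    (directProb H θ s 0 * (weight H (up H s) * conjValue H θ hθ (up H s)) +
      (1 - directProb H θ s 0) * (weight H (down H s) * conjValue H θ hθ (down H s))) + conjRew H s
  simp only [conjValue, conjRew, mul_div_cancel₀ _ (hv _)]
  rw [value_directPolicy]
  ring

lemma conjValue_zero (H : ℕ) (θ : Param H) (hθ : θ ∈ feasible H) :
    conjValue H θ hθ 0 = objective H θ := by
  simp [conjValue, objective, hθ, weight]

/-- The reward sits only in the last state, whose weight is at least 3^(H+1)/(4H). This is the
source of the exponential smallness. -/
lemma norm_conjRew_le {H : ℕ} (hH : 1 ≤ H) : ‖conjRew H‖ ≤ 4 * H / 3 ^ (H + 1) := by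
  have h : (1 : ℝ) ≤ H := by exact_mod_cast hH
  rw [pi_norm_le_iff_of_nonneg (by positivity)]
  intro s
  unfold conjRew rew
  split_ifs with hs
  · rw [hs, Fin.val_last, Real.norm_of_nonneg (div_nonneg zero_le_one (weight_pos _ _).le),
      div_le_iff₀ (weight_pos _ _), div_mul_eq_mul_div, le_div_iff₀ (by positivity)]
    have e : 4 * (H : ℝ) * weight H (H + 1) = 4 * H - 1 + 3 ^ (H + 1) := by
      unfold weight
      field_simp
      ring
    rw [e]
    linarith
  · simp only [zero_div, norm_zero]
    positivity

section

variable {H : ℕ} (hH : 1 ≤ H) {θ : Param H} (hθ : θ ∈ feasible H)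
  (hθ1 : ∀ s, IsInner H s → θ (s, 0) < 1 / 4)

include hH hθ hθ1

lemma norm_stepOp_lt_one : ‖stepOp H θ‖ < 1 :=
  (norm_stepOp_le hH hθ hθ1).trans_lt (sub_lt_self _ (by positivity))

lemma norm_inverse_one_sub_stepOp_le : ‖Ring.inverse (1 - stepOp H θ)‖ ≤ 2 * ((H : ℝ) + 1) := by
  refine (norm_inverse_one_sub_le (norm_stepOp_lt_one hH hθ hθ1)).trans ?_
  have h := norm_stepOp_le hH hθ hθ1
  have h2 : 1 / (2 * ((H : ℝ) + 1)) ≤ 1 - ‖stepOp H θ‖ := by linarith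
  have h3 := inv_anti₀ (by positivity) h2
  rwa [one_div, inv_inv] at h3

lemma norm_conjValue_le : ‖conjValue H θ hθ‖ ≤ 8 * H * (H + 1) / 3 ^ (H + 1) := by
  rw [← inverse_one_sub_apply_of_eq (norm_stepOp_lt_one hH hθ hθ1) (conjValue_eq H θ hθ)]
  refine (ContinuousLinearMap.le_opNorm _ _).trans ?_
  refine (mul_le_mul (norm_inverse_one_sub_stepOp_le hH hθ hθ1) (norm_conjRew_le hH)
    (norm_nonneg _) (by positivity)).trans_eq ?_
  ring

/-- With V' the value at θ', V' = A V' + D V' + r; applying R = (1 - A)⁻¹ gives V' = R D V' + V,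
because R r = V. -/
lemma objective_eq_resolvent {θ' : Param H} (hθ' : θ' ∈ feasible H)
    (hs : ‖Ring.inverse (1 - stepOp H θ) * stepDir hH (θ' - θ)‖ < 1) :
    objective H θ' = Ring.inverse (1 - Ring.inverse (1 - stepOp H θ) * stepDir hH (θ' - θ))
      (conjValue H θ hθ) 0 := by
  have hA := norm_stepOp_lt_one hH hθ hθ1
  rw [← conjValue_zero H θ' hθ']
  refine congrFun (inverse_one_sub_apply_of_eq hs ?_).symm 0
  have h := conjValue_eq H θ' hθ'
  rw [stepOp_add_stepDir hH θ θ', add_apply, add_assoc] at h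
  rw [← inverse_one_sub_apply_of_eq hA (conjValue_eq H θ hθ), mul_apply_eq_comp,
    ← map_add, inverse_one_sub_apply_of_eq hA h]

end

/-- The feasible set is convex with nonempty interior, so derivatives within it are unique even at
boundary points. -/
lemma uniqueDiffOn_feasible (H : ℕ) : UniqueDiffOn ℝ (feasible H) := by
  refine uniqueDiffOn_convex ?_ ?_
  · intro x hx y hy a b ha hb hab s i
    have e : directProb H (a • x + b • y) s i =
        a * directProb H x s i + b * directProb H y s i := by
      unfold directProb
      split_ifs
      · fin_cases i <;> simp
        linear_combination -hab
      · fin_cases i <;> simp [hab]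
    rw [e]
    exact add_nonneg (mul_nonneg ha (hx s i)) (mul_nonneg hb (hy s i))
  · have ho : IsOpen {x : Param H | ∀ s, (∀ i, 0 < x (s, i)) ∧
        0 < 1 - x (s, 0) - x (s, 1) - x (s, 2)} := by
      simp only [Set.ofPred_forall, Set.ofPred_and]
      refine isOpen_iInter_of_finite fun s => (isOpen_iInter_of_finite fun i => ?_).inter ?_
      · exact isOpen_lt continuous_const (by fun_prop)
      · exact isOpen_lt continuous_const (by fun_prop)
    -- The uniform policy is an interior point.
    refine ⟨WithLp.toLp 2 fun _ => 1 / 4, interior_maximal (fun x hx s i => ?_) ho ?_⟩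
    · obtain ⟨h1, h2⟩ := hx s
      unfold directProb
      split_ifs
      · fin_cases i
        exacts [(h1 0).le, (h1 1).le, (h1 2).le, h2.le]
      · fin_cases i <;> simp
    · intro s
      norm_num

/-! ### The gap to the optimal value. -/

/-- The value of the policy that always moves to the right. -/
lemma le_optValue {H : ℕ} (hH : 1 ≤ H) :
    ((H : ℝ) + 1) * ((H : ℝ) / (H + 1)) ^ (H + 1) ≤ (chain H).optValue 0 := by
  let θ : Param H := WithLp.toLp 2 fun x => if x.2 = 0 then 1 else 0
  have hp : ∀ s, directProb H θ s = ![1, 0, 0, 0] := fun s => by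
    unfold directProb
    split_ifs
    · simp [θ]
    · rfl
  have hθ : θ ∈ feasible H := fun s a => by
    rw [hp]
    fin_cases a <;> simp
  have hv : ∀ s, (chain H).value (directPolicy H θ hθ) s =
      rew H s + (H : ℝ) / (H + 1) * (chain H).value (directPolicy H θ hθ) (up H s) := fun s => by
    rw [value_directPolicy, hp]
    simp
  have hpos : (0 : ℝ) < H + 1 := by positivity
  -- Here k counts the steps remaining to the rewarding state, whose own value is 1/(1 - γ) = H + 1.
  have hk : ∀ k (hk : k ≤ H + 1), (chain H).value (directPolicy H θ hθ)
      ⟨H + 1 - k, by omega⟩ = ((H : ℝ) + 1) * ((H : ℝ) / (H + 1)) ^ k := by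
    intro k
    induction k with
    | zero =>
      intro _
      have h := hv (Fin.last (H + 1))
      have hu : up H (Fin.last (H + 1)) = Fin.last (H + 1) := by simp [up, next, Fin.ext_iff]
      rw [hu, rew, if_pos rfl] at h
      change (chain H).value (directPolicy H θ hθ) (Fin.last (H + 1)) = _
      field_simp at h
      linarith
    | succ k ih =>
      intro hk
      rw [hv, pow_succ, ← mul_assoc, ← ih (by omega), mul_comm]
      have hu : up H ⟨H + 1 - (k + 1), by omega⟩ = ⟨H + 1 - k, by omega⟩ := by
        simp [up, next, Fin.ext_iff]
        omega
      have hr : rew H ⟨H + 1 - (k + 1), by omega⟩ = 0 := by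
        rw [rew, if_neg]
        simp [Fin.ext_iff]
        omega
      rw [hu, hr, zero_add, mul_comm]
  have h := hk (H + 1) le_rfl
  rw [← h]
  have h0 : (⟨H + 1 - (H + 1), by omega⟩ : Fin (H + 2)) = 0 := by simp
  rw [h0]
  exact FiniteMDP.value_le_optValue _ _ _

lemma quarter_le_pow {H : ℕ} (hH : 4 ≤ H) : (1 : ℝ) / 4 ≤ ((H : ℝ) / (H + 1)) ^ (H + 1) := by
  have h : (4 : ℝ) ≤ H := by exact_mod_cast hH
  have h1 : (1 + 1 / (H : ℝ)) ^ H ≤ 2.7182818286 := by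
    calc (1 + 1 / (H : ℝ)) ^ H ≤ Real.exp (1 / H) ^ H := by
          gcongr
          rw [add_comm]
          exact Real.add_one_le_exp _
      _ = Real.exp 1 := by
          rw [← Real.exp_nat_mul, mul_one_div_cancel (by positivity)]
      _ ≤ _ := Real.exp_one_lt_d9.le
  have h2 : 1 + 1 / (H : ℝ) ≤ 1.25 := by
    have : 1 / (H : ℝ) ≤ 1 / 4 := by gcongr
    linarith
  have h3 : (1 + 1 / (H : ℝ)) ^ (H + 1) ≤ 4 := by
    rw [pow_succ]
    calc _ ≤ (2.7182818286 : ℝ) * 1.25 := by gcongr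
      _ ≤ 4 := by norm_num
  have e : (H : ℝ) / (H + 1) = (1 + 1 / (H : ℝ))⁻¹ := by
    field_simp
  rw [e, inv_pow, one_div]
  exact inv_anti₀ (by positivity) h3

lemma pow_bound_of_le_three {H : ℕ} (h1 : 1 ≤ H) (h3 : H ≤ 3) :
    ((H : ℝ) + 1) / 8 - ((H : ℝ) + 1) ^ 2 / 3 ^ H ≤ 0 := by
  interval_cases H <;> norm_num

lemma pow_bound_of_four_le {H : ℕ} (hH : 4 ≤ H) : 40 * (H : ℝ) ≤ 24 + 3 * 3 ^ H := by
  induction H, hH using Nat.le_induction with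
  | base => norm_num
  | succ n hn ih =>
    have h : (4 : ℝ) ≤ n := by exact_mod_cast hn
    rw [pow_succ]
    push_cast
    linarith

/-- For H ≤ 3 the lower bound is nonpositive, so optimality is enough. From H = 4 on, the optimal
value is at least (H+1)/4, and the claim reduces to `pow_bound_of_four_le`, which fails at H = 3. -/
lemma gap_le {H : ℕ} (hH : 1 ≤ H) {θ : Param H} (hθ : θ ∈ feasible H)
    (hθ1 : ∀ s, IsInner H s → θ (s, 0) < 1 / 4) :
    ((H : ℝ) + 1) / 8 - ((H : ℝ) + 1) ^ 2 / 3 ^ H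
      ≤ (chain H).optValue 0 - (chain H).value (directPolicy H θ hθ) 0 := by
  rcases le_or_gt H 3 with h3 | h4
  · exact (pow_bound_of_le_three hH h3).trans
      (sub_nonneg.2 (FiniteMDP.value_le_optValue _ _ _))
  · have hV : (chain H).value (directPolicy H θ hθ) 0 ≤ 8 * H * (H + 1) / 3 ^ (H + 1) := by
      have h := (norm_le_pi_norm (conjValue H θ hθ) 0).trans (norm_conjValue_le hH hθ hθ1)
      have e : conjValue H θ hθ 0 = (chain H).value (directPolicy H θ hθ) 0 := by
        simp [conjValue, weight]
      rw [e] at h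
      exact (Real.le_norm_self _).trans h
    have ho := le_optValue hH
    have hq := mul_le_mul_of_nonneg_left (quarter_le_pow h4) (by positivity : (0 : ℝ) ≤ H + 1)
    have hb : 8 * (H : ℝ) * (H + 1) / 3 ^ (H + 1) ≤ (H + 1) / 8 + (H + 1) ^ 2 / 3 ^ H := by
      have hb := pow_bound_of_four_le h4
      have e : ((H : ℝ) + 1) / 8 + (H + 1) ^ 2 / 3 ^ H - 8 * H * (H + 1) / 3 ^ (H + 1) =
          (H + 1) / (24 * 3 ^ H) * (24 + 3 * 3 ^ H - 40 * H) := by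
        field_simp
        ring
      have : 0 ≤ ((H : ℝ) + 1) / (24 * 3 ^ H) * (24 + 3 * 3 ^ H - 40 * H) :=
        mul_nonneg (by positivity) (by linarith)
      linarith
    linarith

/-! ### Numerical estimate and conclusion. -/

/-- Every factor but 3^(-H) is absorbed into (2H)^(3k+4) = exp((3k+4) log(2H)). The range of k makes
this at most exp(3H/4) ≤ 3^(3H/4), with much room to spare. -/
lemma derivative_bound {H k : ℕ} (hH : 1 ≤ H)
    (hk : (k : ℝ) ≤ (H : ℝ) / (40 * Real.log (2 * (H : ℝ))) - 1) :
    (k.factorial : ℝ) * (8 * H * (H + 1) / 3 ^ (H + 1) * (8 * H) ^ k) ≤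
      (1 / 3 : ℝ) ^ ((H : ℝ) / 4) := by
  have h : (1 : ℝ) ≤ H := by exact_mod_cast hH
  set l := Real.log (2 * (H : ℝ)) with hl
  have hl0 : 0 < l := Real.log_pos (by linarith)
  have hkl : ((k : ℝ) + 1) * (40 * l) ≤ H := by
    rw [← le_div_iff₀ (by positivity)]
    linarith
  have hexp : ∀ n : ℕ, (2 * (H : ℝ)) ^ n = Real.exp (n * l) := fun n => by
    rw [Real.exp_nat_mul, Real.exp_log (by positivity)]
  have hl2 : (1 : ℝ) / 2 ≤ l := by
    have := Real.log_two_gt_d9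
    have := Real.log_le_log (by norm_num : (0 : ℝ) < 2) (by linarith : (2 : ℝ) ≤ 2 * H)
    linarith
  have hkH : (k : ℝ) ≤ H := by nlinarith [(Nat.cast_nonneg k : (0 : ℝ) ≤ k)]
  have h1 : (k.factorial : ℝ) ≤ H ^ k := by
    have : (k.factorial : ℝ) ≤ k ^ k := by exact_mod_cast k.factorial_le_pow
    exact this.trans (by gcongr)
  have h3 : Real.exp H ≤ 3 ^ H := by
    rw [← mul_one (H : ℝ), Real.exp_nat_mul]
    have := Real.exp_one_lt_d9
    gcongr
    linarith
  calc (k.factorial : ℝ) * (8 * H * (H + 1) / 3 ^ (H + 1) * (8 * H) ^ k)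
      ≤ H ^ k * ((2 * H) ^ 4 / 3 ^ H * (8 * H) ^ k) := by
        gcongr
        · nlinarith [pow_le_pow_right₀ h (by norm_num : 2 ≤ 4)]
        · norm_num
        · omega
    _ = (8 * (H : ℝ) ^ 2) ^ k * (2 * H) ^ 4 / 3 ^ H := by
        have e : (8 * (H : ℝ) ^ 2) ^ k = H ^ k * (8 * H) ^ k := by
          rw [← mul_pow]
          ring
        rw [e]
        ring
    _ ≤ ((2 * (H : ℝ)) ^ 3) ^ k * (2 * H) ^ 4 / 3 ^ H := by
        gcongr
        nlinarith [pow_le_pow_right₀ h (by norm_num : 2 ≤ 3)]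
    _ = Real.exp (((3 * k + 4 : ℕ) : ℝ) * l) / 3 ^ H := by
        rw [← hexp, pow_add, pow_mul]
    _ ≤ Real.exp (3 / 4 * H) / 3 ^ H := by
        refine div_le_div_of_nonneg_right (Real.exp_le_exp.2 ?_) (by positivity)
        push_cast
        nlinarith [(Nat.cast_nonneg k : (0 : ℝ) ≤ k)]
    _ = (Real.exp H) ^ (3 / 4 : ℝ) / 3 ^ H := by
        rw [← Real.exp_mul]
        ring_nf
    _ ≤ (3 ^ H) ^ (3 / 4 : ℝ) / 3 ^ H := by
        gcongr
    _ = (1 / 3 : ℝ) ^ ((H : ℝ) / 4) := by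
        rw [one_div, Real.inv_rpow (by norm_num), ← Real.rpow_neg (by norm_num),
          ← Real.rpow_natCast, ← Real.rpow_mul (by norm_num), ← Real.rpow_sub (by norm_num)]
        congr 1
        ring

end ChainMDP

theorem mainTheorem6 (H : ℕ) (hH : 1 ≤ H) (θ : ChainMDP.Param H)
    (hθ : θ ∈ ChainMDP.feasible H)
    (hθ01 : ∀ s, ChainMDP.IsInner H s → ∀ a, 0 < θ (s, a) ∧ θ (s, a) < 1)
    (hθ1 : ∀ s, ChainMDP.IsInner H s → θ (s, 0) < 1 / 4) :
    ContDiffWithinAt ℝ ∞ (ChainMDP.objective H) (ChainMDP.feasible H) θ ∧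
    (∀ k : ℕ, (k : ℝ) ≤ (H : ℝ) / (40 * Real.log (2 * (H : ℝ))) - 1 →
      ‖iteratedFDerivWithin ℝ k (ChainMDP.objective H) (ChainMDP.feasible H) θ‖
        ≤ (1 / 3 : ℝ) ^ ((H : ℝ) / 4)) ∧
    ((H : ℝ) + 1) / 8 - ((H : ℝ) + 1) ^ 2 / 3 ^ H
      ≤ (ChainMDP.chain H).optValue 0
        - (ChainMDP.chain H).value (ChainMDP.directPolicy H θ hθ) 0 := by
  have hpos : (0 : ℝ) < H + 1 := by positivity
  let X := Fin (H + 2) → ℝ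
  let R : X →L[ℝ] X := Ring.inverse (1 - ChainMDP.stepOp H θ)
  -- `T` is z ↦ R D z, and `L` applies an operator to V and evaluates at the start, where the weight
  -- is 1.
  let T : ChainMDP.Param H →L[ℝ] (X →L[ℝ] X) :=
    (ContinuousLinearMap.mul ℝ (X →L[ℝ] X) R).comp (ChainMDP.stepDir hH)
  let L : (X →L[ℝ] X) →L[ℝ] ℝ := (ContinuousLinearMap.proj 0).comp
    (ContinuousLinearMap.apply ℝ X (ChainMDP.conjValue H θ hθ))
  -- The bound is 2(H+1) · 4H/(H+1): the discount in D cancels the H + 1 from the resolvent.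
  have hT : ‖T‖ ≤ 8 * H := by
    refine (ContinuousLinearMap.opNorm_comp_le _ _).trans ?_
    refine (mul_le_mul ((ContinuousLinearMap.opNorm_mul_apply_le ℝ _ R).trans
      (ChainMDP.norm_inverse_one_sub_stepOp_le hH hθ hθ1)) (ChainMDP.norm_stepDir_le hH)
      (by positivity) (by positivity)).trans_eq ?_
    field_simp
    ring
  have hL : ‖L‖ ≤ 8 * H * (H + 1) / 3 ^ (H + 1) := by
    refine ContinuousLinearMap.opNorm_le_bound _ (by positivity) fun Y => ?_
    refine (norm_le_pi_norm (Y (ChainMDP.conjValue H θ hθ)) 0).trans ?_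
    refine (Y.le_opNorm _).trans ?_
    rw [mul_comm]
    gcongr
    exact ChainMDP.norm_conjValue_le hH hθ hθ1
  obtain ⟨h1, h2⟩ := contDiffWithinAt_and_norm_iteratedFDerivWithin_le_of_resolvent
    (ChainMDP.uniqueDiffOn_feasible H) hθ T L (f := ChainMDP.objective H)
    fun θ' hθ' hs => ChainMDP.objective_eq_resolvent hH hθ hθ1 hθ' hs
  refine ⟨h1, fun k hk => ?_, ChainMDP.gap_le hH hθ hθ1⟩
  refine (h2 k).trans (le_trans ?_ (ChainMDP.derivative_bound hH hk))
  gcongr
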